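/- Let $d\ge 1$ and $M\ge 2$. For $m\ge 1$ let $\mathcal C_{2m}=\{1-m,\dots,m\}^d\subset\mathbb Z^d$ be the hypercube of side length $2m$. Start from the constant sandpile $s_0\equiv 2d$ and the odometer $v_0\equiv 0$ on $\mathcal C_{2m}$, and run parallel toppling $$v_{t+1}=v_t+1\{s_t\ge 2d\},\qquad s_{t+1}=s_t+\Delta(v_{t+1}-v_t),$$ where $\Delta f(\mathbf x)=-2d\,f(\mathbf x)+\sum_{|\mathbf y-\mathbf x|=1}f(\mathbf y)$, $|\cdot|$ is the $\ell^1$ norm, and functions are extended by $0$ outside $\mathcal C_{2m}$. Write $v_t^{(m)}$ for the resulting odometer. Let $\mathcal S_m=\{\mathbf x\in\mathbb Z^d: m\ge x_1\ge\cdots\ge x_d\ge 1\}$, let $\partial\mathcal C_{2m}$ be the set of $\mathbf x\in\mathcal C_{2m}$ having some $\mathbf y\notin\mathcal C_{2m}$ with $|\mathbf y-\mathbf x|=1$, and let $$\tau_m=\min\{t\ge 1:\ v_t^{(m)}(\mathbf x)\ge m\text{ for some }\mathbf x\in\partial\mathcal C_{2m}\}.$$ For $0\le i<d$ let $F_i$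 be the set of $\mathbf x\in\mathcal S_M$ of the form $\mathbf x=(x_1,\dots,x_i,1,\dots,1)$ with $x_1,\dots,x_i\ge 2$, and let $e_k$ denote the standard basis vectors. Then $\tau_j$ is finite for $1\le j\le M$, and the following hold. 1. (Self-similarity) For all $1\le j\le M$, $0\le t\le\tau_j$ and $\mathbf x\in\mathcal S_M$ with all coordinates $>M-j$, one has $v_t^{(M)}(\mathbf x)=v_t^{(j)}(\mathbf x-(M-j)(1,\dots,1))$. 2. (Weak facet compatibility) For all $0\le i<d$, $\mathbf x\in F_i$ and $t\ge 1$: if $v_t^{(M)}(\mathbf x)=v_t^{(M)}(\mathbf x+e_{i+1})+1$, then $v_{t+1}^{(M)}(\mathbf x)=v_t^{(M)}(\mathbf x)$. 3. (Strong facet compatibility) For all $0\le i<d$, $\mathbf x\in F_i$ and $t\ge 0$ such that $t<\tau_M$, or $i\ge 1$ and $t\ge\tau_M$: $$v_t^{(M)}(\mathbf x)-v_t^{(M)}(\mathbf x+2e_{i+1})\le 2,$$ and if $v_t^{(M)}(\mathbf x)=v_t^{(M)}(\mathbf x+e_{i+1})+1$, then $v_{t+1}^{(M)}(\mathbf x)=v_t^{(M)}(\mathbf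 x)$ and $v_{t+1}^{(M)}(\mathbf x+e_{i+1})=v_t^{(M)}(\mathbf x+e_{i+1})+1$. 4. (Strong topple control) For all $t\ge\tau_{M-1}$, $\ \sup_{\mathbf x\in\mathcal S_M}\bigl(v_{t+2}^{(M)}(\mathbf x)-v_t^{(M)}(\mathbf x)\bigr)\le 1$. -/

import Mathlib

namespace HypercubeSandpile

/-- The hypercube of side length `2 * M` in `ℤ^d`: all coordinates lie in `{1 - M, …, M}`. -/
abbrev InCube (d M : ℕ) (x : Fin d → ℤ) : Prop :=
  ∀ i, 1 - (M : ℤ) ≤ x i ∧ x i ≤ (M : ℤ)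

/-- The `i`-th standard basis vector of `ℤ^d`. -/
def basisVec {d : ℕ} (i : Fin d) : Fin d → ℤ := Pi.single i 1

/-- The graph Laplacian on `ℤ^d`. Applied to a function that vanishes off a hypercube, it is
the Laplacian of the hypercube with dissipating boundary. -/
def laplacian {d : ℕ} (f : (Fin d → ℤ) → ℤ) (x : Fin d → ℤ) : ℤ :=
  -(2 * (d : ℤ)) * f x + ∑ i : Fin d, (f (x + basisVec i) + f (x - basisVec i))

/-- The sites of the hypercube that topple in the configuration `s`: those with at least
`2 * d` chips. The value is `0` off the hypercube. -/
def topplings (d M : ℕ) (s : (Fin d → ℤ) → ℤ) (x : Fin d → ℤ) : ℤ :=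
  if InCube d M x ∧ 2 * (d : ℤ) ≤ s x then 1 else 0

/-- Parallel toppling: the pair (odometer, sandpile) at each time, started from the zero
odometer and the constant sandpile `2 * d`. Only the values of the sandpile on the hypercube
ever matter; the odometer vanishes off the hypercube. -/
def process (d M : ℕ) : ℕ → ((Fin d → ℤ) → ℤ) × ((Fin d → ℤ) → ℤ)
  | 0 => (fun _ => 0, fun _ => 2 * (d : ℤ))
  | t + 1 =>
    (fun x => (process d M t).1 x + topplings d M (process d M t).2 x,
     fun x => (process d M t).2 x + laplacian (topplings d M (process d M t).2) x)

/-- The parallel toppling odometer at time `t` on the hypercube of side length `2 * M`. -/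
def odometer (d M t : ℕ) : (Fin d → ℤ) → ℤ := (process d M t).1

/-- The sorted fundamental domain `M ≥ x₁ ≥ ⋯ ≥ x_d ≥ 1` of the hypercube. -/
def sortedDomain (d M : ℕ) : Set (Fin d → ℤ) :=
  {x | (∀ i, 1 ≤ x i ∧ x i ≤ (M : ℤ)) ∧ Antitone x}

/-- The inner boundary of the hypercube: its sites with a nearest neighbour outside. -/
def innerBoundary (d M : ℕ) : Set (Fin d → ℤ) :=
  {x | InCube d M x ∧ ∃ y : Fin d → ℤ, ¬ InCube d M y ∧ ∑ i, |y i - x i| = 1}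

/-- The times `t ≥ 1` by which some boundary site of the hypercube of side length `2 * j` has
toppled at least `j` times. -/
def boundaryTimes (d j : ℕ) : Set ℕ :=
  {t | 1 ≤ t ∧ ∃ x ∈ innerBoundary d j, (j : ℤ) ≤ odometer d j t x}

/-- The first time at which a boundary site of the hypercube of side length `2 * j` has toppled
at least `j` times. -/
noncomputable def tau (d j : ℕ) : ℕ := sInf (boundaryTimes d j)

/-- The points of the fundamental domain of the form `(x₁, …, x_i, 1, 1, …, 1)` with
`x₁, …, x_i ≥ 2`. With coordinates numbered from `0`, the first `1` stands in position `i`. -/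
def facetPoints (d M : ℕ) (i : Fin d) : Set (Fin d → ℤ) :=
  {x | x ∈ sortedDomain d M ∧ (∀ k, k < i → 2 ≤ x k) ∧ (∀ k, i ≤ k → x k = 1)}

end HypercubeSandpile

namespace HypercubeSandpile

/-! ### Second differences and the Laplacian -/

variable {d M : ℕ}

/-! Since `s_t = 2d + Δ v_t`, a site of the cube topples exactly when `Δ v_t ≥ 0`. Hence an
inequality `v_t(x) ≤ v_{t'}(y) + c` survives one step if, wherever it is an equality, the Laplacians
are ordered the same way (`odometer_succ_le`). Most bounds below are inductions on time through this
principle.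

The core compares the odometer with its translates: for `x_k ≥ 1`, always `v_{t+1}(x) ≤ v_t(x + e_k)
+ x_k`, and `v_t(x) ≤ v_{t+1}(x + e_k) + x_k - 1` for `t < τ_M`, or at any time if `x_k < x_l` for
some `l`. The offsets are affine in `x` and cancel in second differences, so the work lies at the
edges of the region. At `x_k = 1` the first bound is weak facet compatibility, and the two together
give the strong form.

The second bound, in the small cube, also gives self-similarity: a point outside the shifted orthant
is compared with its projection, at the price of one time unit per unit of `ℓ¹` distance
(`odometer_le_odometer_push`).

Topple control holds because no site topples twice in a row outside a shrinking box of sites that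
topple at every step. The box is gone in time, as `τ_{M-1} ≥ M - 1`. -/

lemma basisVec_same (k : Fin d) : basisVec k k = 1 := by simp [basisVec]

lemma basisVec_of_ne {i k : Fin d} (h : i ≠ k) : basisVec k i = 0 := by simp [basisVec, h]

/-- The second difference of `f` in direction `i`. -/
def secondDiff (f : (Fin d → ℤ) → ℤ) (i : Fin d) (x : Fin d → ℤ) : ℤ :=
  f (x + basisVec i) + f (x - basisVec i) - 2 * f x

lemma laplacian_eq_sum (f : (Fin d → ℤ) → ℤ) (x : Fin d → ℤ) :
    laplacian f x = ∑ i, secondDiff f i x := by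
  simp only [laplacian, secondDiff, Finset.sum_sub_distrib, Finset.sum_const, Finset.card_univ,
    Fintype.card_fin, nsmul_eq_mul]
  ring

lemma laplacian_add (f g : (Fin d → ℤ) → ℤ) (x : Fin d → ℤ) :
    laplacian (fun y => f y + g y) x = laplacian f x + laplacian g x := by
  simp only [laplacian_eq_sum, ← Finset.sum_add_distrib]
  exact Finset.sum_congr rfl fun i _ => by simp only [secondDiff]; ring

lemma laplacian_mono {f g : (Fin d → ℤ) → ℤ} {x y : Fin d → ℤ}
    (h : ∀ i, secondDiff f i x ≤ secondDiff g i y) : laplacian f x ≤ laplacian g y := by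
  rw [laplacian_eq_sum, laplacian_eq_sum]
  exact Finset.sum_le_sum fun i _ => h i

lemma laplacian_mono_pair {f g : (Fin d → ℤ) → ℤ} {x y : Fin d → ℤ} {k l : Fin d} (hkl : k ≠ l)
    (h : ∀ i, i ≠ k → i ≠ l → secondDiff f i x ≤ secondDiff g i y)
    (h' : secondDiff f k x + secondDiff f l x ≤ secondDiff g k y + secondDiff g l y) :
    laplacian f x ≤ laplacian g y := by
  have key (u : Fin d → ℤ) : ∑ i, u i = u k + u l + ∑ i ∈ (Finset.univ.erase k).erase l, u i := by
    rw [← Finset.add_sum_erase _ u (Finset.mem_univ k),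
      ← Finset.add_sum_erase _ u (Finset.mem_erase.2 ⟨hkl.symm, Finset.mem_univ l⟩), add_assoc]
  rw [laplacian_eq_sum, laplacian_eq_sum, key, key]
  refine add_le_add h' (Finset.sum_le_sum fun i hi => ?_)
  simp only [Finset.mem_erase, Finset.mem_univ, and_true] at hi
  exact h i hi.2 hi.1

/-! ### The recursion for the odometer -/

lemma process_snd (t : ℕ) (x : Fin d → ℤ) :
    (process d M t).2 x = 2 * (d : ℤ) + laplacian (process d M t).1 x := by
  induction t with
  | zero => simp [process, laplacian]
  | succ t ih => simp only [process, laplacian_add, ih]; ring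

lemma odometer_zero (x : Fin d → ℤ) : odometer d M 0 x = 0 := rfl

lemma odometer_succ (t : ℕ) (x : Fin d → ℤ) :
    odometer d M (t + 1) x = odometer d M t x +
      if InCube d M x ∧ 0 ≤ laplacian (odometer d M t) x then 1 else 0 := by
  change (process d M t).1 x + topplings d M (process d M t).2 x = _
  rw [topplings, process_snd]
  simp only [odometer, le_add_iff_nonneg_right]
  congr

lemma odometer_le_succ (t : ℕ) (x : Fin d → ℤ) : odometer d M t x ≤ odometer d M (t + 1) x := by
  rw [odometer_succ]; split_ifs <;> omega

lemma odometer_succ_le_add_one (t : ℕ) (x : Fin d → ℤ) :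
    odometer d M (t + 1) x ≤ odometer d M t x + 1 := by
  rw [odometer_succ]; split_ifs <;> omega

lemma odometer_succ_of_laplacian_nonneg {t : ℕ} {x : Fin d → ℤ} (hx : InCube d M x)
    (h : 0 ≤ laplacian (odometer d M t) x) :
    odometer d M (t + 1) x = odometer d M t x + 1 := by
  rw [odometer_succ, if_pos ⟨hx, h⟩]

lemma inCube_and_laplacian_nonneg {t : ℕ} {x : Fin d → ℤ}
    (h : odometer d M t x < odometer d M (t + 1) x) :
    InCube d M x ∧ 0 ≤ laplacian (odometer d M t) x := by
  by_contra hc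
  rw [odometer_succ, if_neg hc] at h
  omega

lemma odometer_of_not_inCube (t : ℕ) {x : Fin d → ℤ} (hx : ¬ InCube d M x) :
    odometer d M t x = 0 := by
  induction t with
  | zero => rfl
  | succ t ih => rw [odometer_succ, if_neg (fun h => hx h.1), ih, add_zero]

lemma odometer_nonneg (t : ℕ) (x : Fin d → ℤ) : 0 ≤ odometer d M t x := by
  induction t with
  | zero => exact le_rfl
  | succ t ih => exact ih.trans (odometer_le_succ t x)

lemma odometer_le_time (t : ℕ) (x : Fin d → ℤ) : odometer d M t x ≤ t := by
  induction t with
  | zero => exact le_rfl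
  | succ t ih => have := odometer_succ_le_add_one (M := M) t x; push_cast; omega

/-- One step of the comparison principle for parallel toppling. -/
lemma odometer_succ_le {M' t t' : ℕ} {x y : Fin d → ℤ} {c : ℤ} (hy : InCube d M' y)
    (h : odometer d M t x ≤ odometer d M' t' y + c)
    (h' : odometer d M t x = odometer d M' t' y + c →
      odometer d M (t + 1) x = odometer d M t x + 1 →
      laplacian (odometer d M t) x ≤ laplacian (odometer d M' t') y) :
    odometer d M (t + 1) x ≤ odometer d M' (t' + 1) y + c := by
  have h1 := odometer_succ_le_add_one (M := M) t x
  have h2 := odometer_le_succ (M := M') t' y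
  rcases h.lt_or_eq with hlt | heq
  · omega
  · by_cases hs : odometer d M (t + 1) x = odometer d M t x + 1
    · have h3 := inCube_and_laplacian_nonneg (M := M) (t := t) (x := x) (by omega)
      rw [odometer_succ_of_laplacian_nonneg hy (h3.2.trans (h' heq hs))]
      omega
    · omega

/-! ### Symmetries -/

lemma odometer_comp {σ : (Fin d → ℤ) → (Fin d → ℤ)} (hσ : ∀ x, InCube d M (σ x) ↔ InCube d M x)
    (hL : ∀ f x, laplacian f (σ x) = laplacian (fun y => f (σ y)) x) (t : ℕ) (x : Fin d → ℤ) :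
    odometer d M t (σ x) = odometer d M t x := by
  induction t generalizing x with
  | zero => rfl
  | succ t ih => simp only [odometer_succ, hσ, hL, ih]

lemma odometer_reflect (k : Fin d) (t : ℕ) (x : Fin d → ℤ) :
    odometer d M t (Function.update x k (1 - x k)) = odometer d M t x := by
  refine odometer_comp (σ := fun x => Function.update x k (1 - x k)) (fun x => ?_)
    (fun f x => ?_) t x
  · refine forall_congr' fun i => ?_
    by_cases h : i = k
    · subst h; simp only [Function.update_self]; omega
    · simp [Function.update_of_ne h]
  · rw [laplacian_eq_sum, laplacian_eq_sum]
    refine Finset.sum_congr rfl fun i _ => ?_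
    have hs : ∀ s : ℤ, Function.update (x + s • basisVec i) k (1 - (x + s • basisVec i) k) =
        Function.update x k (1 - x k) + (if i = k then -s else s) • basisVec i := by
      intro s
      ext j
      by_cases hj : j = k
      · subst hj
        by_cases hi : i = j
        · subst hi; simp [basisVec_same]; ring
        · simp [basisVec_of_ne (Ne.symm hi), hi]
      · by_cases hi : i = k
        · subst hi; simp [Function.update_of_ne hj, basisVec_of_ne hj]
        · simp [Function.update_of_ne hj, hi]
    have h1 := hs 1
    have h2 := hs (-1)
    simp only [one_smul, neg_smul, ← sub_eq_add_neg] at h1 h2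
    simp only [secondDiff]
    rw [h1, h2]
    split_ifs
    · simp only [neg_smul, one_smul, neg_neg, ← sub_eq_add_neg]; ring
    · simp only [neg_smul, one_smul, ← sub_eq_add_neg]

lemma odometer_swap (k l : Fin d) (t : ℕ) (x : Fin d → ℤ) :
    odometer d M t (fun i => x (Equiv.swap k l i)) = odometer d M t x := by
  refine odometer_comp (σ := fun x i => x (Equiv.swap k l i)) (fun x => ?_) (fun f x => ?_) t x
  · exact (Equiv.swap k l).forall_congr_right (q := fun i => 1 - (M : ℤ) ≤ x i ∧ x i ≤ M)
  · rw [laplacian_eq_sum, laplacian_eq_sum, ← Equiv.sum_comp (Equiv.swap k l)]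
    refine Finset.sum_congr rfl fun i _ => ?_
    have hb : basisVec ((Equiv.swap k l) i) = fun j => basisVec i (Equiv.swap k l j) := by
      ext j
      simp only [basisVec, Pi.single_apply, Equiv.swap_apply_eq_iff]
    simp only [secondDiff, hb]
    rfl

lemma odometer_sub_basisVec {k : Fin d} {x : Fin d → ℤ} (hx : x k = 1) (t : ℕ) :
    odometer d M t (x - basisVec k) = odometer d M t x := by
  rw [← odometer_reflect k t x]
  congr 1
  ext i
  by_cases h : i = k
  · subst h; simp [hx, basisVec_same]
  · simp [Function.update_of_ne h, basisVec_of_ne h]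

lemma odometer_add_basisVec {k : Fin d} {x : Fin d → ℤ} (hx : x k = 0) (t : ℕ) :
    odometer d M t (x + basisVec k) = odometer d M t x := by
  rw [← odometer_sub_basisVec (k := k) (x := x + basisVec k) (by simp [hx, basisVec_same]),
    add_sub_cancel_right]

lemma inCube_of_add {k : Fin d} {x : Fin d → ℤ} (h : InCube d M (x + basisVec k))
    (hx : 1 - (M : ℤ) ≤ x k) : InCube d M x := by
  intro i
  have hi := h i
  by_cases hik : i = k
  · subst hik; simp only [Pi.add_apply, basisVec_same] at hi; omega
  · simpa [basisVec_of_ne hik] using hi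

lemma inCube_add {k : Fin d} {x : Fin d → ℤ} (h : InCube d M x) (hx : x k < M) :
    InCube d M (x + basisVec k) := by
  intro i
  have hi := h i
  by_cases hik : i = k
  · subst hik; simp only [Pi.add_apply, basisVec_same]; omega
  · simpa [basisVec_of_ne hik] using hi

/-! ### Gradient bounds -/

lemma odometer_add_le {k : Fin d} (t : ℕ) {x : Fin d → ℤ} (hx : 0 ≤ x k) :
    odometer d M t (x + basisVec k) ≤ odometer d M t x := by
  induction t generalizing x with
  | zero => exact le_rfl
  | succ t ih =>
    by_cases hc : InCube d M (x + basisVec k)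
    swap
    · rw [odometer_of_not_inCube _ hc]; exact odometer_nonneg _ _
    rcases hx.eq_or_lt with h0 | h1
    · exact (odometer_add_basisVec h0.symm _).le
    have hcx : InCube d M x := by
      refine inCube_of_add hc ?_
      have := hc k
      simp only [Pi.add_apply, basisVec_same] at this
      omega
    have := odometer_succ_le (c := 0) hcx (by simpa using ih hx) (fun heq _ => ?_)
    · simpa using this
    refine laplacian_mono fun i => ?_
    simp only [secondDiff, heq, add_zero]
    have e1 : x + basisVec k + basisVec i = x + basisVec i + basisVec k := by abel
    have e2 : x + basisVec k - basisVec i = x - basisVec i + basisVec k := by abel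
    rw [e1, e2]
    have h1 : odometer d M t (x + basisVec i + basisVec k) ≤ odometer d M t (x + basisVec i) := by
      apply ih
      by_cases hik : k = i
      · subst hik; simp only [Pi.add_apply, basisVec_same]; omega
      · simpa [basisVec_of_ne hik] using hx
    have h2 : odometer d M t (x - basisVec i + basisVec k) ≤ odometer d M t (x - basisVec i) := by
      apply ih
      by_cases hik : k = i
      · subst hik; simp only [Pi.sub_apply, basisVec_same]; omega
      · simpa [basisVec_of_ne hik] using hx
    omega

/-- Half the right side is a strictly concave barrier in `x_k` that vanishes just outside the cube.
At a point of contact the Laplacian is at most `-1`, so the site cannot topple. -/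
lemma two_mul_odometer_le (k : Fin d) (t : ℕ) {x : Fin d → ℤ}
    (h1 : -(M : ℤ) ≤ x k) (h2 : x k ≤ M + 1) :
    2 * odometer d M t x ≤ (M + x k) * (M + 1 - x k) := by
  induction t generalizing x with
  | zero =>
    rw [odometer_zero]
    exact (mul_nonneg (by omega) (by omega)).trans' (by simp)
  | succ t ih =>
    by_cases hc : InCube d M x
    swap
    · rw [odometer_of_not_inCube _ hc]
      exact (mul_nonneg (by omega) (by omega)).trans' (by simp)
    have hle := odometer_succ_le_add_one (M := M) t x
    by_contra! hlt
    have ih0 := ih h1 h2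
    -- By parity, the odometer must equal half the barrier before it can exceed it.
    have hev : Even ((M + x k) * (M + 1 - x k)) := by
      rw [Int.even_mul]
      rcases Int.even_or_odd (M + x k) with h | h
      · exact Or.inl h
      · right
        rw [Int.even_iff]; rw [Int.odd_iff] at h; omega
    obtain ⟨r, hr⟩ := hev
    have hlt' : odometer d M t x < odometer d M (t + 1) x := by omega
    have heq : 2 * odometer d M t x = (M + x k) * (M + 1 - x k) := by omega
    obtain ⟨-, hlap⟩ := inCube_and_laplacian_nonneg hlt'
    have hxk := hc k
    have hi : ∀ i, secondDiff (odometer d M t) i x ≤ if i = k then -1 else 0 := by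
      intro i
      by_cases hik : i = k
      · subst hik
        have a1 := ih (x := x + basisVec i) (by simp [basisVec_same]; omega)
          (by simp [basisVec_same]; omega)
        have a2 := ih (x := x - basisVec i) (by simp [basisVec_same]; omega)
          (by simp [basisVec_same]; omega)
        simp only [Pi.add_apply, Pi.sub_apply, basisVec_same] at a1 a2
        simp only [secondDiff, if_true]
        nlinarith
      · have a1 := ih (x := x + basisVec i) (by simp [basisVec_of_ne (Ne.symm hik)]; omega)
          (by simp [basisVec_of_ne (Ne.symm hik)]; omega)
        have a2 := ih (x := x - basisVec i) (by simp [basisVec_of_ne (Ne.symm hik)]; omega)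
          (by simp [basisVec_of_ne (Ne.symm hik)]; omega)
        simp only [Pi.add_apply, Pi.sub_apply, basisVec_of_ne (Ne.symm hik), add_zero,
          sub_zero] at a1 a2
        simp only [secondDiff, if_neg hik]
        omega
    have := Finset.sum_le_sum fun i (_ : i ∈ Finset.univ) => hi i
    rw [← laplacian_eq_sum, Finset.sum_ite_eq' Finset.univ k] at this
    simp only [Finset.mem_univ, if_true] at this
    omega

lemma odometer_le_of_apply_eq {k : Fin d} (t : ℕ) {x : Fin d → ℤ} (hx : x k = M) :
    odometer d M t x ≤ M := by
  have := two_mul_odometer_le (M := M) k t (x := x) (by omega) (by omega)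
  rw [hx] at this
  nlinarith

/-- The edge `x_k = 0` is settled by reflection, and the edge `x_k = M` by the barrier, which equals
`M` there. -/
lemma odometer_le_add_basisVec {k : Fin d} (t : ℕ) {x : Fin d → ℤ} (hx : 0 ≤ x k) :
    odometer d M t x ≤ odometer d M t (x + basisVec k) + x k := by
  induction t generalizing x with
  | zero => simpa [odometer_zero] using hx
  | succ t ih =>
    have hnn := odometer_nonneg (M := M) (t + 1) (x + basisVec k)
    by_cases hc : InCube d M x
    swap
    · rw [odometer_of_not_inCube _ hc]; omega
    rcases hx.eq_or_lt with h0 | h1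
    · rw [odometer_add_basisVec h0.symm]; omega
    rcases (hc k).2.eq_or_lt with hM | hM
    · have := odometer_le_of_apply_eq (t + 1) hM
      omega
    refine odometer_succ_le (inCube_add hc hM) (ih hx) (fun heq _ => laplacian_mono fun i => ?_)
    simp only [secondDiff]
    by_cases hik : k = i
    · subst hik
      have a1 := ih (x := x + basisVec k) (by simp [basisVec_same]; omega)
      have a2 := ih (x := x - basisVec k) (by simp [basisVec_same]; omega)
      simp only [Pi.add_apply, Pi.sub_apply, basisVec_same, sub_add_cancel,
        add_sub_cancel_right] at a1 a2 ⊢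
      omega
    · have a1 := ih (x := x + basisVec i) (by simp [basisVec_of_ne hik]; omega)
      have a2 := ih (x := x - basisVec i) (by simp [basisVec_of_ne hik]; omega)
      have e1 : x + basisVec k + basisVec i = x + basisVec i + basisVec k := by abel
      have e2 : x + basisVec k - basisVec i = x - basisVec i + basisVec k := by abel
      simp only [Pi.add_apply, Pi.sub_apply, basisVec_of_ne hik, add_zero, sub_zero] at a1 a2
      rw [e1, e2]
      omega

/-! ### Topple control -/

/-- All coordinates of `x` are at distance more than `t` from the outside of the cube. -/
def Deep (d M t : ℕ) (x : Fin d → ℤ) : Prop :=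
  ∀ i, 1 - (M : ℤ) + t ≤ x i ∧ x i ≤ (M : ℤ) - t

lemma Deep.mono {s t : ℕ} {x : Fin d → ℤ} (h : Deep d M t x) (hst : s ≤ t) : Deep d M s x :=
  fun i => by have := h i; omega

lemma Deep.add {t : ℕ} {x : Fin d → ℤ} (h : Deep d M (t + 1) x) (k : Fin d) :
    Deep d M t (x + basisVec k) := by
  intro i
  have hi := h i
  by_cases hik : i = k
  · subst hik; simp only [Pi.add_apply, basisVec_same]; omega
  · simp only [Pi.add_apply, basisVec_of_ne hik]; omega

lemma Deep.sub {t : ℕ} {x : Fin d → ℤ} (h : Deep d M (t + 1) x) (k : Fin d) :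
    Deep d M t (x - basisVec k) := by
  intro i
  have hi := h i
  by_cases hik : i = k
  · subst hik; simp only [Pi.sub_apply, basisVec_same]; omega
  · simp only [Pi.sub_apply, basisVec_of_ne hik]; omega

lemma Deep.inCube {t : ℕ} {x : Fin d → ℤ} (h : Deep d M t x) : InCube d M x :=
  fun i => by have := h i; omega

lemma odometer_succ_of_deep {t : ℕ} {x : Fin d → ℤ} (h : Deep d M t x) :
    odometer d M (t + 1) x = t + 1 := by
  induction t generalizing x with
  | zero =>
    rw [odometer_succ_of_laplacian_nonneg h.inCube]
    · simp [odometer_zero]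
    · simp [laplacian, odometer_zero]
  | succ t ih =>
    have h0 := ih (h.mono t.le_succ)
    rw [odometer_succ_of_laplacian_nonneg h.inCube, h0]
    · push_cast; ring
    · rw [laplacian_eq_sum]
      refine Finset.sum_nonneg fun i _ => ?_
      simp only [secondDiff, ih (h.add i), ih (h.sub i), h0]
      omega

lemma odometer_succ_le_of_not_deep {t : ℕ} {x : Fin d → ℤ} (h : ¬ Deep d M t x) :
    odometer d M (t + 1) x ≤ t := by
  induction t generalizing x with
  | zero =>
    rw [odometer_of_not_inCube]
    · simp
    · exact fun hc => h fun i => by have := hc i; simpa using this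
  | succ t ih =>
    have hle := odometer_succ_le_add_one (M := M) (t + 1) x
    by_cases hd : Deep d M t x
    swap
    · have := ih hd; push_cast; omega
    have h0 := odometer_succ_of_deep hd
    by_contra! hlt
    push_cast at hlt
    obtain ⟨-, hlap⟩ := inCube_and_laplacian_nonneg (M := M) (t := t + 1) (x := x) (by omega)
    have hb (y : Fin d → ℤ) := odometer_le_time (M := M) (t + 1) y
    push_cast at hb
    -- The odometer attains its maximal value `t + 1` at `x`, so a nonnegative Laplacian forces the
    -- same value at every neighbour.
    have hz : ∀ i, secondDiff (odometer d M (t + 1)) i x = 0 := by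
      have hle : ∀ i ∈ Finset.univ, secondDiff (odometer d M (t + 1)) i x ≤ 0 := fun i _ => by
        have := hb (x + basisVec i)
        have := hb (x - basisVec i)
        simp only [secondDiff]
        omega
      rw [laplacian_eq_sum] at hlap
      intro i
      exact (Finset.sum_eq_zero_iff_of_nonpos hle).1 (le_antisymm (Finset.sum_nonpos hle) hlap) i
        (Finset.mem_univ i)
    have hnb : ∀ i, Deep d M t (x + basisVec i) ∧ Deep d M t (x - basisVec i) := by
      intro i
      have hi := hz i
      have b1 := hb (x + basisVec i)
      have b2 := hb (x - basisVec i)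
      simp only [secondDiff] at hi
      constructor
      · by_contra hn
        have := ih hn
        omega
      · by_contra hn
        have := ih hn
        omega
    refine h fun i => ?_
    have h1 := (hnb i).1 i
    have h2 := (hnb i).2 i
    simp only [Pi.add_apply, Pi.sub_apply, basisVec_same] at h1 h2
    push_cast
    omega

lemma odometer_add_two_le_of_not_deep {t : ℕ} {x : Fin d → ℤ} (h : ¬ Deep d M (t + 1) x) :
    odometer d M (t + 2) x ≤ odometer d M t x + 1 := by
  induction t generalizing x with
  | zero =>
    have := odometer_succ_le_of_not_deep h
    simpa [odometer_zero] using this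
  | succ t ih =>
    by_cases hd : Deep d M t x
    · have h0 := odometer_succ_of_deep hd
      have h1 := odometer_succ_le_of_not_deep h
      push_cast at h1
      change odometer d M (t + 1 + 1 + 1) x ≤ _
      omega
    have hd' : ¬ Deep d M (t + 1) x := fun h => hd (h.mono t.le_succ)
    by_cases hc : InCube d M x
    swap
    · simp [odometer_of_not_inCube _ hc]
    refine odometer_succ_le hc (ih hd') (fun heq _ => laplacian_mono fun i => ?_)
    -- A neighbour in `Deep (t + 1)` would put `x` in `Deep t`, so the induction hypothesis applies
    -- to all neighbours.
    have a1 := ih (x := x + basisVec i)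
      fun hn => hd (by simpa using hn.sub i)
    have a2 := ih (x := x - basisVec i)
      fun hn => hd (by simpa using hn.add i)
    simp only [secondDiff]
    omega

lemma odometer_add_two_le (hd : 1 ≤ d) {t : ℕ} (ht : M ≤ t + 1) (x : Fin d → ℤ) :
    odometer d M (t + 2) x ≤ odometer d M t x + 1 :=
  odometer_add_two_le_of_not_deep fun h => by
    have := h ⟨0, hd⟩
    push_cast at this
    omega

/-! ### Comparison of the odometer with its translates at consecutive times -/

lemma odometer_succ_le_add_basisVec {k : Fin d} (t : ℕ) {x : Fin d → ℤ} (hx : 1 ≤ x k) :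
    odometer d M (t + 1) x ≤ odometer d M t (x + basisVec k) + x k := by
  induction t generalizing x with
  | zero =>
    have := odometer_succ_le_add_one (M := M) 0 x
    simp only [odometer_zero] at *
    omega
  | succ t ih =>
    have hnn := odometer_nonneg (M := M) (t + 1) (x + basisVec k)
    by_cases hc : InCube d M x
    swap
    · rw [odometer_of_not_inCube _ hc]; omega
    rcases (hc k).2.eq_or_lt with hM | hM
    · have := odometer_le_of_apply_eq (t + 1 + 1) hM
      omega
    -- Topple control is unavailable at these sites, but there `x + e_k` has toppled at every step
    -- so far.
    by_cases hdeep : x k = 1 ∧ Deep d M (t + 1) x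
    · obtain ⟨hk, hD⟩ := hdeep
      have hD' : Deep d M t (x + basisVec k) := hD.add k
      rw [odometer_succ_of_deep hD', hk]
      exact_mod_cast odometer_le_time (t + 1 + 1) x
    refine odometer_succ_le (inCube_add hc hM) (ih hx) (fun heq hs => laplacian_mono fun i => ?_)
    simp only [secondDiff]
    by_cases hik : k = i
    · subst hik
      have a1 := ih (x := x + basisVec k) (by simp [basisVec_same]; omega)
      -- At `x_k = 1` reflection turns `x - e_k` into `x`. As `x` topples in the next step, topple
      -- control says that it did not topple in this one.
      have a2 : odometer d M (t + 1) (x - basisVec k) ≤ odometer d M t x + (x k - 1) := by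
        rcases hx.eq_or_lt with h1 | h1
        · rw [odometer_sub_basisVec h1.symm]
          have := odometer_add_two_le_of_not_deep fun h => hdeep ⟨h1.symm, h⟩
          change odometer d M (t + 1 + 1) x ≤ _ at this
          omega
        · have := ih (x := x - basisVec k) (by simp [basisVec_same]; omega)
          simpa only [Pi.sub_apply, basisVec_same, sub_add_cancel] using this
      simp only [Pi.add_apply, basisVec_same, add_sub_cancel_right] at a1 ⊢
      omega
    · have a1 := ih (x := x + basisVec i) (by simp [basisVec_of_ne hik]; omega)
      have a2 := ih (x := x - basisVec i) (by simp [basisVec_of_ne hik]; omega)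
      have e1 : x + basisVec k + basisVec i = x + basisVec i + basisVec k := by abel
      have e2 : x + basisVec k - basisVec i = x - basisVec i + basisVec k := by abel
      simp only [Pi.add_apply, Pi.sub_apply, basisVec_of_ne hik, add_zero, sub_zero] at a1 a2
      rw [e1, e2]
      omega

/-- At the neighbour `x - e_k` the equal-time gradient bound is enough, because the toppling of `x`
supplies the missing unit. Hypothesis `hb` is what the face `x_k = M` requires. -/
lemma odometer_le_succ_add_basisVec {k : Fin d} {t : ℕ}
    (hb : ∀ s ≤ t, ∀ x : Fin d → ℤ, InCube d M x → x k = M → odometer d M s x < M)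
    {x : Fin d → ℤ} (hx : 1 ≤ x k) :
    odometer d M t x ≤ odometer d M (t + 1) (x + basisVec k) + (x k - 1) := by
  induction t generalizing x with
  | zero =>
    have hnn := odometer_nonneg (M := M) (0 + 1) (x + basisVec k)
    rw [odometer_zero]
    omega
  | succ t ih =>
    replace ih := @ih fun s hs => hb s (by omega)
    have hnn := odometer_nonneg (M := M) (t + 1 + 1) (x + basisVec k)
    by_cases hc : InCube d M x
    swap
    · rw [odometer_of_not_inCube _ hc]; omega
    rcases (hc k).2.eq_or_lt with hM | hM
    · have := hb _ le_rfl x hc hM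
      omega
    refine odometer_succ_le (inCube_add hc hM) (ih hx) (fun heq hs => laplacian_mono fun i => ?_)
    simp only [secondDiff]
    by_cases hik : k = i
    · subst hik
      have a1 := ih (x := x + basisVec k) (by simp [basisVec_same]; omega)
      have a2 := odometer_le_add_basisVec (M := M) t (x := x - basisVec k) (k := k)
        (by simp [basisVec_same]; omega)
      simp only [Pi.add_apply, Pi.sub_apply, basisVec_same, sub_add_cancel,
        add_sub_cancel_right] at a1 a2 ⊢
      omega
    · have a1 := ih (x := x + basisVec i) (by simp [basisVec_of_ne hik]; omega)
      have a2 := ih (x := x - basisVec i) (by simp [basisVec_of_ne hik]; omega)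
      have e1 : x + basisVec k + basisVec i = x + basisVec i + basisVec k := by abel
      have e2 : x + basisVec k - basisVec i = x - basisVec i + basisVec k := by abel
      simp only [Pi.add_apply, Pi.sub_apply, basisVec_of_ne hik, add_zero, sub_zero] at a1 a2
      rw [e1, e2]
      omega

lemma odometer_eq_of_swap {k l : Fin d} {t : ℕ} {x y : Fin d → ℤ}
    (h1 : x k = y l) (h2 : x l = y k) (h : ∀ i, i ≠ k → i ≠ l → x i = y i) :
    odometer d M t x = odometer d M t y := by
  rw [← odometer_swap k l t y]
  congr 1
  ext i
  by_cases hk : i = k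
  · subst hk; simpa using h1
  by_cases hl : i = l
  · subst hl; simpa using h2
  rw [Equiv.swap_apply_of_ne_of_ne hk hl, h i hk hl]

/-- The condition `x_k < x_l` keeps `x` off the face `x_k = M`, so no bound on time is needed. The
price is a new edge at the diagonal, where directions `k` and `l` have to be compared jointly. -/
lemma odometer_le_succ_add_basisVec_of_lt {k l : Fin d} (t : ℕ) {x : Fin d → ℤ}
    (hx : 1 ≤ x k) (hkl : x k < x l) :
    odometer d M t x ≤ odometer d M (t + 1) (x + basisVec k) + (x k - 1) := by
  have hne : k ≠ l := fun h => by subst h; exact lt_irrefl _ hkl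
  induction t generalizing x with
  | zero =>
    have hnn := odometer_nonneg (M := M) (0 + 1) (x + basisVec k)
    rw [odometer_zero]
    omega
  | succ t ih =>
    have hnn := odometer_nonneg (M := M) (t + 1 + 1) (x + basisVec k)
    by_cases hc : InCube d M x
    swap
    · rw [odometer_of_not_inCube _ hc]; omega
    have hM : x k < M := hkl.trans_le (hc l).2
    refine odometer_succ_le (inCube_add hc hM) (ih hx hkl)
      (fun heq hs => laplacian_mono_pair hne (fun i hik hil => ?_) ?_)
    · have a1 := ih (x := x + basisVec i) (by simp [basisVec_of_ne (Ne.symm hik)]; omega)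
        (by simp [basisVec_of_ne (Ne.symm hik), basisVec_of_ne (Ne.symm hil)]; omega)
      have a2 := ih (x := x - basisVec i) (by simp [basisVec_of_ne (Ne.symm hik)]; omega)
        (by simp [basisVec_of_ne (Ne.symm hik), basisVec_of_ne (Ne.symm hil)]; omega)
      have e1 : x + basisVec k + basisVec i = x + basisVec i + basisVec k := by abel
      have e2 : x + basisVec k - basisVec i = x - basisVec i + basisVec k := by abel
      simp only [Pi.add_apply, Pi.sub_apply, basisVec_of_ne (Ne.symm hik), add_zero,
        sub_zero] at a1 a2
      simp only [secondDiff]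
      rw [e1, e2]
      omega
    have b1 := odometer_le_add_basisVec (M := M) t (x := x - basisVec k) (k := k)
      (by simp [basisVec_same]; omega)
    have b2 := ih (x := x + basisVec l) (by simp [basisVec_of_ne hne]; omega)
      (by simp [basisVec_of_ne hne, basisVec_same]; omega)
    have e1 : x + basisVec k + basisVec l = x + basisVec l + basisVec k := by abel
    have e2 : x + basisVec k - basisVec l = x - basisVec l + basisVec k := by abel
    simp only [Pi.add_apply, Pi.sub_apply, basisVec_same, sub_add_cancel, basisVec_of_ne hne,
      add_zero] at b1 b2
    simp only [secondDiff, e1, e2, add_sub_cancel_right]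
    -- Next to the diagonal, `x + e_k` and `x - e_l` leave the region. Exchanging coordinates `k`
    -- and `l` identifies `x - e_l + e_k` with `x`, and `x + 2e_k` with `x + e_l + e_k`.
    by_cases hadj : x l = x k + 1
    · have s1 : odometer d M (t + 1) (x - basisVec l + basisVec k) = odometer d M (t + 1) x :=
        odometer_eq_of_swap (k := k) (l := l)
          (by simp [basisVec_same, basisVec_of_ne hne]; omega)
          (by simp [basisVec_same, basisVec_of_ne hne.symm]; omega)
          (fun i h1 h2 => by simp [basisVec_of_ne h1, basisVec_of_ne h2])
      have s2 : odometer d M (t + 1) (x + basisVec k + basisVec k) =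
          odometer d M (t + 1) (x + basisVec l + basisVec k) :=
        odometer_eq_of_swap (k := k) (l := l)
          (by simp [basisVec_same, basisVec_of_ne hne.symm]; omega)
          (by simp [basisVec_same, basisVec_of_ne hne, basisVec_of_ne hne.symm]; omega)
          (fun i h1 h2 => by simp [basisVec_of_ne h1, basisVec_of_ne h2])
      have b3 := odometer_le_add_basisVec (M := M) t (x := x - basisVec l) (k := l)
        (by simp [basisVec_same]; omega)
      simp only [Pi.sub_apply, basisVec_same, sub_add_cancel] at b3
      have b4 := odometer_succ_le_add_basisVec (M := M) t (x := x) (k := l) (by omega)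
      have b5 := odometer_le_succ (M := M) t (x + basisVec k)
      omega
    · have b3 := ih (x := x - basisVec l) (by simp [basisVec_of_ne hne]; omega)
        (by simp [basisVec_of_ne hne, basisVec_same]; omega)
      have b4 := ih (x := x + basisVec k) (by simp [basisVec_same]; omega)
        (by simp [basisVec_of_ne hne.symm, basisVec_same]; omega)
      simp only [Pi.add_apply, Pi.sub_apply, basisVec_same, basisVec_of_ne hne, sub_zero] at b3 b4
      omega

/-- The two gradient bounds alone give `1 + 2`. If the first is attained, `h` makes `x + e_k`
topple, and the time-shifted bound then lowers the second to `1`. -/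
lemma odometer_sub_two_basisVec_le {k : Fin d} {t : ℕ} {x : Fin d → ℤ} (hx : x k = 1)
    (h : odometer d M t x ≤ odometer d M (t + 1) (x + basisVec k)) :
    odometer d M t x - odometer d M t (x + 2 • basisVec k) ≤ 2 := by
  have h1 := odometer_le_add_basisVec (M := M) t (x := x) (k := k) (by omega)
  have h2 := odometer_le_add_basisVec (M := M) t (x := x + basisVec k) (k := k)
    (by simp [basisVec_same]; omega)
  have h3 := odometer_succ_le_add_basisVec (M := M) t (x := x + basisVec k) (k := k)
    (by simp [basisVec_same]; omega)
  have e : x + 2 • basisVec k = x + basisVec k + basisVec k := by rw [two_smul, add_assoc]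
  rw [e]
  simp only [Pi.add_apply, basisVec_same] at h2 h3
  have h4 := odometer_add_le (M := M) t (x := x) (k := k) (by omega)
  omega

/-! ### The boundary times -/

lemma mem_innerBoundary {k : Fin d} {x : Fin d → ℤ} (hc : InCube d M x) (hx : x k = M) :
    x ∈ innerBoundary d M := by
  refine ⟨hc, x + basisVec k, fun h => ?_, ?_⟩
  · have := (h k).2
    simp only [Pi.add_apply, basisVec_same] at this
    omega
  · rw [Finset.sum_eq_single k]
    · simp [basisVec_same]
    · intro i _ hik
      simp [basisVec_of_ne hik]
    · simp

lemma odometer_lt_of_lt_tau {k : Fin d} (hM : 1 ≤ M) {s : ℕ} (hs : s < tau d M) {x : Fin d → ℤ}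
    (hc : InCube d M x) (hx : x k = M) : odometer d M s x < M := by
  rcases Nat.eq_zero_or_pos s with rfl | h0
  · rw [odometer_zero]; omega
  · by_contra! hle
    exact Nat.notMem_of_lt_sInf hs ⟨h0, x, mem_innerBoundary hc hx, hle⟩

lemma odometer_le_succ_add_basisVec_of_lt_tau {k : Fin d} (hM : 1 ≤ M) {t : ℕ}
    (ht : t < tau d M) {x : Fin d → ℤ} (hx : x k = 1) :
    odometer d M t x ≤ odometer d M (t + 1) (x + basisVec k) := by
  have := odometer_le_succ_add_basisVec (M := M) (t := t) (k := k) (x := x)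
    (fun s hs x hc hx => odometer_lt_of_lt_tau hM (hs.trans_lt ht) hc hx) (by omega)
  omega

/-- Otherwise `v_t(1) ≤ v_{t+1}(1 + e_k)` for all `t`, where `1` is the all-ones site. If that site
skips a step, its Laplacian is then nonnegative and it topples in the next. Its odometer would grow
without bound, against the quadratic barrier. -/
lemma boundaryTimes_nonempty (hd : 1 ≤ d) (hM : 1 ≤ M) : (boundaryTimes d M).Nonempty := by
  by_contra hne
  have hb : ∀ s, ∀ k : Fin d, ∀ x : Fin d → ℤ, InCube d M x → x k = M →
      odometer d M s x < M := by
    intro s k x hc hx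
    rcases Nat.eq_zero_or_pos s with rfl | h0
    · rw [odometer_zero]; omega
    · by_contra! hle
      exact hne ⟨s, h0, x, mem_innerBoundary hc hx, hle⟩
  have hc : InCube d M 1 := fun i => by simp only [Pi.one_apply]; omega
  have hlap : ∀ t, (∀ k, odometer d M t 1 ≤ odometer d M t (1 + basisVec k)) →
      odometer d M (t + 1) 1 = odometer d M t 1 + 1 := by
    intro t ht
    refine odometer_succ_of_laplacian_nonneg hc ?_
    rw [laplacian_eq_sum]
    refine Finset.sum_nonneg fun k _ => ?_
    rw [secondDiff, odometer_sub_basisVec (by simp)]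
    have := ht k
    omega
  have htwo : ∀ t, odometer d M t 1 + 1 ≤ odometer d M (t + 2) 1 := by
    intro t
    by_contra! hlt
    have h1 := odometer_le_succ (M := M) t (1 : Fin d → ℤ)
    have h2 := odometer_le_succ (M := M) (t + 1) (1 : Fin d → ℤ)
    have h3 := hlap (t + 1) fun k => by
      have := odometer_le_succ_add_basisVec (M := M) (t := t) (k := k) (x := 1)
        (fun s _ => hb s k) (by simp)
      simp only [Pi.one_apply] at this
      change odometer d M (t + 1 + 1) 1 < _ at hlt
      omega
    change odometer d M (t + 1 + 1) 1 < _ at hlt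
    omega
  have hgrow : ∀ n : ℕ, (n : ℤ) ≤ odometer d M (2 * n) 1 := by
    intro n
    induction n with
    | zero => exact odometer_nonneg _ _
    | succ n ih => have := htwo (2 * n); rw [mul_add, mul_one]; push_cast; omega
  have h1 := two_mul_odometer_le (M := M) ⟨0, hd⟩ (2 * (M * M + M)) (x := 1)
    (by simp only [Pi.one_apply]; omega) (by simp only [Pi.one_apply]; omega)
  have h2 := hgrow (M * M + M)
  simp only [Pi.one_apply] at h1
  push_cast at h2
  nlinarith

lemma le_tau (hd : 1 ≤ d) (hM : 1 ≤ M) : M ≤ tau d M := by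
  obtain ⟨-, x, -, h⟩ := Nat.sInf_mem (boundaryTimes_nonempty hd hM)
  exact_mod_cast h.trans (odometer_le_time (tau d M) x)

/-! ### Self-similarity -/

lemma odometer_sub_le_odometer {g j : ℕ} (hM : M = j + g) (t : ℕ) (x : Fin d → ℤ) :
    odometer d j t (fun k => x k - g) ≤ odometer d M t x := by
  induction t generalizing x with
  | zero => exact le_rfl
  | succ t ih =>
    by_cases hc : InCube d j (fun k => x k - g)
    swap
    · rw [odometer_of_not_inCube _ hc]; exact odometer_nonneg _ _
    have hcM : InCube d M x := fun i => by have := hc i; simp only at this; omega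
    have := odometer_succ_le (M := j) (t := t) (x := fun k => x k - g) (c := 0) hcM
      (by simpa using ih x) (fun heq _ => laplacian_mono fun i => ?_)
    · simpa using this
    have a1 := ih (x + basisVec i)
    have a2 := ih (x - basisVec i)
    have e1 : (fun k => (x + basisVec i) k - (g : ℤ)) = (fun k => x k - (g : ℤ)) + basisVec i := by
      ext k; simp only [Pi.add_apply]; ring
    have e2 : (fun k => (x - basisVec i) k - (g : ℤ)) = (fun k => x k - (g : ℤ)) - basisVec i := by
      ext k; simp only [Pi.sub_apply]; ring
    rw [e1] at a1
    rw [e2] at a2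
    simp only [secondDiff]
    omega

/-- The nearest point of the shifted orthant, in the coordinates of the smaller cube. -/
def push (g : ℕ) (y : Fin d → ℤ) : Fin d → ℤ := fun k => max (y k - g) 1

/-- The `ℓ¹` distance of `y` to the orthant of points with all coordinates above `g`. -/
def lag (g : ℕ) (y : Fin d → ℤ) : ℕ := ∑ k, (g + 1 - y k).toNat

lemma lag_add_basisVec {g : ℕ} {y : Fin d → ℤ} {k : Fin d} :
    lag g (y + basisVec k) + (if y k ≤ g then 1 else 0) = lag g y := by
  have h : ∀ i, (if i = k then (if y k ≤ g then 1 else 0) else 0) +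
      (g + 1 - (y + basisVec k) i).toNat = ((g : ℤ) + 1 - y i).toNat := by
    intro i
    by_cases hik : i = k
    · subst hik
      simp only [Pi.add_apply, basisVec_same, if_true]
      split_ifs <;> omega
    · simp [basisVec_of_ne hik, hik]
  unfold lag
  rw [← Finset.sum_congr rfl fun i _ => h i, Finset.sum_add_distrib, Finset.sum_ite_eq']
  simp [add_comm]

lemma push_add_basisVec_of_le {g : ℕ} {y : Fin d → ℤ} {k : Fin d} (h : y k ≤ g) :
    push g (y + basisVec k) = push g y := by
  ext i
  by_cases hik : i = k
  · subst hik; simp only [push, Pi.add_apply, basisVec_same]; omega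
  · simp [push, basisVec_of_ne hik]

lemma push_add_basisVec_of_lt {g : ℕ} {y : Fin d → ℤ} {k : Fin d} (h : g < y k) :
    push g (y + basisVec k) = push g y + basisVec k := by
  ext i
  by_cases hik : i = k
  · subst hik; simp only [push, Pi.add_apply, basisVec_same]; omega
  · simp [push, basisVec_of_ne hik]

/-- In a direction with `y_i ≤ g`, moving to `y + e_i` keeps the projection and lowers the lag by
one; the time-shifted bound at coordinate `1` of the small cube, valid before `τ_j`, makes up for
that unit. -/
lemma odometer_le_odometer_push {g j : ℕ} (hM : M = j + g) (hj : 1 ≤ j) {t : ℕ} {y : Fin d → ℤ}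
    (hy : ∀ k, 1 ≤ y k) (ht : t + lag g y ≤ tau d j) :
    odometer d M t y ≤ odometer d j (t + lag g y) (push g y) := by
  induction t generalizing y with
  | zero => exact odometer_nonneg _ _
  | succ t ih =>
    by_cases hc : InCube d M y
    swap
    · rw [odometer_of_not_inCube _ hc]; exact odometer_nonneg _ _
    have hcj : InCube d j (push g y) := fun i => by
      have := hc i
      simp only [push]
      omega
    rw [add_right_comm] at ht ⊢
    -- If the projected site topples, the bound is immediate. Otherwise its odometer is unchanged
    -- over the step, which absorbs the extra unit of lag at `y - e_i`.
    by_cases hs : odometer d j (t + lag g y + 1) (push g y) = odometer d j (t + lag g y) (push g y)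
    swap
    · have h1 := odometer_succ_le_add_one (M := M) t y
      have h2 := ih hy (by omega)
      have h3 := odometer_le_succ (M := j) (t + lag g y) (push g y)
      omega
    have := odometer_succ_le (M := M) (t := t) (x := y) (c := 0) hcj
      (by simpa using ih hy (by omega)) (fun heq _ => laplacian_mono fun i => ?_)
    · simpa using this
    have hsub : 2 ≤ y i → odometer d M t (y - basisVec i) ≤
        odometer d j (t + lag g (y - basisVec i)) (push g (y - basisVec i)) := by
      intro h2
      have hl := lag_add_basisVec (g := g) (y := y - basisVec i) (k := i)
      refine ih (fun k => ?_) ?_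
      · have := hy k
        by_cases hik : k = i
        · subst hik; simp only [Pi.sub_apply, basisVec_same]; omega
        · simpa [basisVec_of_ne hik] using this
      · rw [sub_add_cancel] at hl
        split_ifs at hl <;> omega
    have hlag := lag_add_basisVec (g := g) (y := y) (k := i)
    have hadd := ih (y := y + basisVec i) (fun k => by
      have := hy k
      by_cases hik : k = i
      · subst hik; simp only [Pi.add_apply, basisVec_same]; omega
      · simpa [basisVec_of_ne hik] using this) (by split_ifs at hlag <;> omega)
    have hlag' := lag_add_basisVec (g := g) (y := y - basisVec i) (k := i)
    simp only [sub_add_cancel, Pi.sub_apply, basisVec_same] at hlag'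
    have hdown : y i ≤ g + 1 → odometer d M t (y - basisVec i) ≤
        odometer d j (t + lag g y) (push g y) := by
      intro hyi
      rcases (hy i).eq_or_lt with h1 | h1
      · rw [odometer_sub_basisVec h1.symm]; omega
      · have hsub' := hsub (by omega)
        rw [if_pos (by omega)] at hlag'
        rw [← hs, add_assoc, hlag']
        have hp := push_add_basisVec_of_le (g := g) (y := y - basisVec i) (k := i)
          (by simp only [Pi.sub_apply, basisVec_same]; omega)
        rw [sub_add_cancel] at hp
        rwa [hp]
    simp only [secondDiff]
    rcases le_or_gt (y i) g with hle | hlt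
    · rw [if_pos hle] at hlag
      rw [push_add_basisVec_of_le hle] at hadd
      have hpi : push g y i = 1 := by simp only [push]; omega
      have hS := odometer_le_succ_add_basisVec_of_lt_tau (M := j) (k := i) hj
        (t := t + lag g (y + basisVec i)) (by omega) hpi
      rw [add_assoc, hlag] at hS
      have hd := hdown (by omega)
      rw [odometer_sub_basisVec hpi]
      omega
    · rw [if_neg (by omega), add_zero] at hlag
      rw [push_add_basisVec_of_lt hlt, hlag] at hadd
      rcases (show (g : ℤ) + 1 ≤ y i by omega).eq_or_lt with h1 | h1
      · have hpi : push g y i = 1 := by simp only [push]; omega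
        have hd := hdown (by omega)
        rw [odometer_sub_basisVec hpi]
        omega
      · have hsub' := hsub (by omega)
        rw [if_neg (by omega), add_zero] at hlag'
        have hp := push_add_basisVec_of_lt (g := g) (y := y - basisVec i) (k := i)
          (by simp only [Pi.sub_apply, basisVec_same]; omega)
        rw [sub_add_cancel] at hp
        rw [← hlag', ← sub_eq_of_eq_add hp] at hsub'
        omega

lemma odometer_eq_odometer_sub {j t : ℕ} (hj : 1 ≤ j) (hjM : j ≤ M) (ht : t ≤ tau d j)
    {x : Fin d → ℤ} (hx : ∀ k, (M : ℤ) - j < x k) :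
    odometer d M t x = odometer d j t (fun k => x k - ((M : ℤ) - j)) := by
  obtain ⟨g, rfl⟩ := Nat.exists_eq_add_of_le hjM
  have hg : ((j + g : ℕ) : ℤ) - j = g := by push_cast; ring
  rw [hg] at hx ⊢
  refine le_antisymm ?_ (odometer_sub_le_odometer rfl t x)
  have hlag : lag g x = 0 := Finset.sum_eq_zero fun k _ => by have := hx k; omega
  have hpush : push g x = fun k => x k - (g : ℤ) := by
    ext k
    have := hx k
    simp only [push]
    omega
  have := odometer_le_odometer_push (M := j + g) (t := t) rfl hj (y := x)
    (fun k => by have := hx k; omega) (by omega)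
  rwa [hlag, hpush, add_zero] at this

end HypercubeSandpile

/-! ### Facet compatibility and the main theorem -/

theorem mainTheorem3 (d M : ℕ) (hd : 1 ≤ d) (hM : 2 ≤ M) :
    -- the times `tau d j` are well defined
    (∀ j : ℕ, 1 ≤ j → j ≤ M → (HypercubeSandpile.boundaryTimes d j).Nonempty) ∧
    -- self-similarity
    (∀ j : ℕ, 1 ≤ j → j ≤ M → ∀ t : ℕ, t ≤ HypercubeSandpile.tau d j →
      ∀ x ∈ HypercubeSandpile.sortedDomain d M, (∀ k, (M : ℤ) - (j : ℤ) < x k) →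
        HypercubeSandpile.odometer d M t x =
          HypercubeSandpile.odometer d j t (fun k => x k - ((M : ℤ) - (j : ℤ)))) ∧
    -- weak facet compatibility
    (∀ i : Fin d, ∀ x ∈ HypercubeSandpile.facetPoints d M i, ∀ t : ℕ, 1 ≤ t →
      HypercubeSandpile.odometer d M t x =
          HypercubeSandpile.odometer d M t (x + HypercubeSandpile.basisVec i) + 1 →
        HypercubeSandpile.odometer d M (t + 1) x = HypercubeSandpile.odometer d M t x) ∧
    -- strong facet compatibility
    (∀ i : Fin d, ∀ x ∈ HypercubeSandpile.facetPoints d M i, ∀ t : ℕ,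
      (t < HypercubeSandpile.tau d M ∨ (1 ≤ (i : ℕ) ∧ HypercubeSandpile.tau d M ≤ t)) →
        HypercubeSandpile.odometer d M t x -
            HypercubeSandpile.odometer d M t (x + 2 • HypercubeSandpile.basisVec i) ≤ 2 ∧
        (HypercubeSandpile.odometer d M t x =
            HypercubeSandpile.odometer d M t (x + HypercubeSandpile.basisVec i) + 1 →
          HypercubeSandpile.odometer d M (t + 1) x = HypercubeSandpile.odometer d M t x ∧
          HypercubeSandpile.odometer d M (t + 1) (x + HypercubeSandpile.basisVec i) =
            HypercubeSandpile.odometer d M t (x + HypercubeSandpile.basisVec i) + 1)) ∧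
    -- strong topple control
    (∀ t : ℕ, HypercubeSandpile.tau d (M - 1) ≤ t →
      ∀ x ∈ HypercubeSandpile.sortedDomain d M,
        HypercubeSandpile.odometer d M (t + 2) x - HypercubeSandpile.odometer d M t x ≤ 1) := by
  have weak (i : Fin d) (x : Fin d → ℤ) (hx : x i = 1) (t : ℕ) :
      HypercubeSandpile.odometer d M t x =
          HypercubeSandpile.odometer d M t (x + HypercubeSandpile.basisVec i) + 1 →
        HypercubeSandpile.odometer d M (t + 1) x = HypercubeSandpile.odometer d M t x := by
    intro h
    have h1 := HypercubeSandpile.odometer_succ_le_add_basisVec (M := M) t (x := x) (k := i) (by omega)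
    have h2 := HypercubeSandpile.odometer_le_succ (M := M) t x
    omega
  refine ⟨fun j hj _ => HypercubeSandpile.boundaryTimes_nonempty hd hj,
    fun j hj hjM t ht x _ hx => HypercubeSandpile.odometer_eq_odometer_sub hj hjM ht hx,
    fun i x hx t _ => weak i x (hx.2.2 i le_rfl) t, fun i x hx t ht => ?_, fun t ht x _ => ?_⟩
  · have hxi : x i = 1 := hx.2.2 i le_rfl
    have hS : HypercubeSandpile.odometer d M t x ≤
        HypercubeSandpile.odometer d M (t + 1) (x + HypercubeSandpile.basisVec i) := by
      rcases ht with ht | ⟨hi, -⟩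
      · exact HypercubeSandpile.odometer_le_succ_add_basisVec_of_lt_tau (by omega) ht hxi
      -- For `i ≥ 1` the first coordinate exceeds `x_i = 1`, so the bound that is free of `τ_M`
      -- applies.
      · have h0 : 2 ≤ x ⟨0, hd⟩ := hx.2.1 _ (by rw [Fin.lt_def]; exact hi)
        have := HypercubeSandpile.odometer_le_succ_add_basisVec_of_lt (M := M) (k := i)
          (l := ⟨0, hd⟩) t (x := x) (by omega) (by omega)
        omega
    refine ⟨HypercubeSandpile.odometer_sub_two_basisVec_le hxi hS, fun h => ⟨weak i x hxi t h, ?_⟩⟩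
    have := HypercubeSandpile.odometer_succ_le_add_one (M := M) t
      (x + HypercubeSandpile.basisVec i)
    omega
  · have h1 := HypercubeSandpile.le_tau (M := M - 1) hd (by omega)
    have := HypercubeSandpile.odometer_add_two_le (M := M) hd (t := t) (by omega) x
    omega
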